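/- For integers $n,p,k\ge 1$ and reals $\tau$, $\sigma>0$ consider the Gaussian linear model $y_i=x_i^T\beta+\sigma z_i$, $i=1,\dots,n$, with $x_i\sim\mathcal N(0,\frac1n I_p)$ and $z_i\sim\mathcal N(0,1)$ all independent, and $\beta\in\mathbb R^p$ unknown. Let $$\Theta(k,\tau)=\{\beta\in\mathbb R^p:\ \|\beta\|_0\le k,\ \|\beta\|_2^2\le k\tau^2\},\qquad R(\Theta(k,\tau),\sigma)=\inf_{\hat\beta}\sup_{\beta\in\Theta(k,\tau)}\mathbb E_\beta\|\hat\beta-\beta\|_2^2,$$ where the infimum is over all measurable functions $\hat\beta$ of the data $(x_i,y_i)_{i\le n}$. For $\lambda>0$ let $\hat\beta^R(\lambda)=\arg\min_{b\in\mathbb R^p}\sum_{i=1}^n(y_i-x_i^Tb)^2+\lambda\|b\|_2^2$ be the ridge estimator. Let $n,p,k,\tau,\sigma$ vary along a sequence such that $k/p\to0$, $\tau/\sigma\to\infty$, $\tau/\sigma=o(\sqrt{\log(p/k)})$ (Regime II) and $(k\log(p/k))/n\to0$. Then $$\inf_{\lambda>0}\sup_{\beta\in\Theta(k,\tau)}\mathbb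 E_\beta\|\hat\beta^R(\lambda)-\beta\|_2^2\ \ge\ k\tau^2\Big(1-\frac{k\tau^2}{p\sigma^2}\big(1+o(1)\big)\Big).$$ Moreover ridge regression is minimax suboptimal in the second order: the improvement of optimally tuned ridge over $k\tau^2$ is negligible compared with that of the minimax risk, i.e. $$k\tau^2-\inf_{\lambda>0}\sup_{\beta\in\Theta(k,\tau)}\mathbb E_\beta\|\hat\beta^R(\lambda)-\beta\|_2^2\ =\ o\big(k\tau^2-R(\Theta(k,\tau),\sigma)\big).$$ -/

import Mathlib

open MeasureTheory ProbabilityTheory Filter Asymptotics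
open scoped Topology ENNReal NNReal Matrix

/-- The law of the pair `(X, z)`: the entries of the `n × p` design `X` are i.i.d. `N(0, 1/n)`
(that is, its rows are i.i.d. `N(0, I_p / n)`), the entries of the noise `z` are i.i.d. `N(0, 1)`,
and `X`, `z` are independent. -/
noncomputable def designNoiseLaw (n p : ℕ) : Measure ((Fin n → Fin p → ℝ) × (Fin n → ℝ)) :=
  (Measure.pi fun _ : Fin n => Measure.pi fun _ : Fin p => gaussianReal 0 ((n : ℝ≥0)⁻¹)).prod
    (Measure.pi fun _ : Fin n => gaussianReal 0 1)

/-- The response `y = X β + σ z`, coordinatewise `y_i = x_iᵀ β + σ z_i`. -/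
def response {n p : ℕ} (σ : ℝ) (β : EuclideanSpace ℝ (Fin p))
    (X : Fin n → Fin p → ℝ) (z : Fin n → ℝ) : Fin n → ℝ :=
  fun i => ∑ j, X i j * β j + σ * z i

/-- The risk `𝔼_β ‖β̂ - β‖₂²` of an estimator `β̂ = est (X, y)`, as a value in `[0, ∞]`. -/
noncomputable def risk {n p : ℕ} (σ : ℝ)
    (est : (Fin n → Fin p → ℝ) × (Fin n → ℝ) → EuclideanSpace ℝ (Fin p))
    (β : EuclideanSpace ℝ (Fin p)) : ℝ≥0∞ :=
  ∫⁻ ω, ENNReal.ofReal (‖est (ω.1, response σ β ω.1 ω.2) - β‖ ^ 2) ∂(designNoiseLaw n p)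

/-- The parameter space `Θ(k, τ) = {β ∈ ℝᵖ : ‖β‖₀ ≤ k, ‖β‖₂² ≤ k τ²}`. -/
def paramSpace (p k : ℕ) (τ : ℝ) : Set (EuclideanSpace ℝ (Fin p)) :=
  {β | {j | β j ≠ 0}.ncard ≤ k ∧ ‖β‖ ^ 2 ≤ k * τ ^ 2}

/-- The worst-case risk `sup_{β ∈ Θ(k, τ)} 𝔼_β ‖β̂ - β‖₂²` of an estimator. -/
noncomputable def supRisk {n p : ℕ} (k : ℕ) (τ σ : ℝ)
    (est : (Fin n → Fin p → ℝ) × (Fin n → ℝ) → EuclideanSpace ℝ (Fin p)) : ℝ≥0∞ :=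
  ⨆ β ∈ paramSpace p k τ, risk σ est β

/-- The minimax risk `R(Θ(k, τ), σ)`: the infimum of the worst-case risk over all estimators,
i.e. all measurable functions of the data `(X, y)`. -/
noncomputable def sparseMinimaxRisk (n p k : ℕ) (τ σ : ℝ) : ℝ≥0∞ :=
  ⨅ (est : (Fin n → Fin p → ℝ) × (Fin n → ℝ) → EuclideanSpace ℝ (Fin p))
    (_ : Measurable est), supRisk k τ σ est

/-- The ridge objective `∑ᵢ (yᵢ - xᵢᵀ b)² + lam ‖b‖₂²`. -/
noncomputable def ridgeObjective {n p : ℕ} (lam : ℝ) (X : Matrix (Fin n) (Fin p) ℝ)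
    (y : Fin n → ℝ) (b : EuclideanSpace ℝ (Fin p)) : ℝ :=
  ∑ i, (y i - ∑ j, X i j * b j) ^ 2 + lam * ‖b‖ ^ 2

/-- For `lam > 0` the ridge objective has exactly one minimizer, `(XᵀX + lam I)⁻¹ Xᵀ y`. -/
theorem isMinOn_ridgeObjective_iff {n p : ℕ} {lam : ℝ} (hlam : 0 < lam)
    (X : Matrix (Fin n) (Fin p) ℝ) (y : Fin n → ℝ) (b : EuclideanSpace ℝ (Fin p)) :
    IsMinOn (ridgeObjective lam X y) Set.univ b ↔
      b = WithLp.toLp 2 ((Xᵀ * X + lam • (1 : Matrix (Fin p) (Fin p) ℝ))⁻¹ *ᵥ (Xᵀ *ᵥ y)) := by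
  set A : Matrix (Fin p) (Fin p) ℝ := Xᵀ * X + lam • 1 with hA
  have hpos : A.PosDef := by
    have h1 : (Xᵀ * X).PosSemidef := by
      simpa using Matrix.posSemidef_conjTranspose_mul_self X
    exact Matrix.PosDef.posSemidef_add h1 (Matrix.PosDef.one.smul hlam)
  have hdet : IsUnit A.det := (Matrix.isUnit_iff_isUnit_det A).1 hpos.isUnit
  set c : Fin p → ℝ := A⁻¹ *ᵥ (Xᵀ *ᵥ y) with hc
  have hAc : A *ᵥ c = Xᵀ *ᵥ y := by
    rw [hc, Matrix.mulVec_mulVec, Matrix.mul_nonsing_inv A hdet, Matrix.one_mulVec]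
  have hobj : ∀ v : EuclideanSpace ℝ (Fin p), ridgeObjective lam X y v =
      (y - X *ᵥ v.ofLp) ⬝ᵥ (y - X *ᵥ v.ofLp) + lam * (v.ofLp ⬝ᵥ v.ofLp) := by
    intro v
    simp only [ridgeObjective, EuclideanSpace.real_norm_sq_eq, dotProduct, Matrix.mulVec,
      Pi.sub_apply]
    simp only [pow_two]
  have hkey : ∀ v : EuclideanSpace ℝ (Fin p), ridgeObjective lam X y v =
      ridgeObjective lam X y (WithLp.toLp 2 c) +
        ((X *ᵥ (v.ofLp - c)) ⬝ᵥ (X *ᵥ (v.ofLp - c)) +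
          lam * ((v.ofLp - c) ⬝ᵥ (v.ofLp - c))) := by
    intro v
    obtain ⟨d, hd⟩ : ∃ d, v.ofLp = c + d := ⟨v.ofLp - c, by simp⟩
    have hcross : (X *ᵥ c) ⬝ᵥ (X *ᵥ d) + lam * (c ⬝ᵥ d) = y ⬝ᵥ (X *ᵥ d) := by
      have h := congrArg (fun w => w ⬝ᵥ d) hAc
      simp only [hA, Matrix.add_mulVec, add_dotProduct, Matrix.smul_mulVec,
        Matrix.one_mulVec, smul_dotProduct, smul_eq_mul, ← Matrix.mulVec_mulVec] at h
      rw [Matrix.mulVec_transpose, Matrix.mulVec_transpose, ← Matrix.dotProduct_mulVec,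
        ← Matrix.dotProduct_mulVec] at h
      exact h
    rw [hobj, hobj, hd, add_sub_cancel_left, Matrix.mulVec_add]
    simp only [sub_dotProduct, dotProduct_sub, add_dotProduct, dotProduct_add]
    rw [dotProduct_comm (X *ᵥ d) (X *ᵥ c), dotProduct_comm d c, dotProduct_comm (X *ᵥ d) y]
    rw [← hcross]
    ring
  constructor
  · intro h
    have h1 := isMinOn_univ_iff.1 h (WithLp.toLp 2 c)
    rw [hkey b] at h1
    have h2 : 0 ≤ (X *ᵥ (b.ofLp - c)) ⬝ᵥ (X *ᵥ (b.ofLp - c)) :=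
      Finset.sum_nonneg fun i _ => mul_self_nonneg _
    have h3 : 0 ≤ (b.ofLp - c) ⬝ᵥ (b.ofLp - c) :=
      Finset.sum_nonneg fun i _ => mul_self_nonneg _
    have h4 : (b.ofLp - c) ⬝ᵥ (b.ofLp - c) = 0 := by
      rcases h3.eq_or_lt with h | h
      · exact h.symm
      · nlinarith [mul_pos hlam h]
    have h5 : b.ofLp - c = 0 := dotProduct_self_eq_zero.1 h4
    ext i
    have := congrFun h5 i
    simpa [sub_eq_zero] using this
  · rintro rfl
    refine isMinOn_univ_iff.2 fun v => ?_
    rw [hkey v]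
    have h2 : 0 ≤ (X *ᵥ (v.ofLp - c)) ⬝ᵥ (X *ᵥ (v.ofLp - c)) :=
      Finset.sum_nonneg fun i _ => mul_self_nonneg _
    have h3 : 0 ≤ (v.ofLp - c) ⬝ᵥ (v.ofLp - c) :=
      Finset.sum_nonneg fun i _ => mul_self_nonneg _
    nlinarith [mul_nonneg hlam.le h3]

/-- The ridge estimator: a minimizer of the ridge objective (the unique one when `lam > 0`). -/
noncomputable def ridgeEstimator {n p : ℕ} (lam : ℝ)
    (data : (Fin n → Fin p → ℝ) × (Fin n → ℝ)) : EuclideanSpace ℝ (Fin p) :=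
  Classical.epsilon fun b => IsMinOn (ridgeObjective lam data.1 data.2) Set.univ b

theorem ridgeEstimator_eq {n p : ℕ} {lam : ℝ} (hlam : 0 < lam)
    (X : Matrix (Fin n) (Fin p) ℝ) (y : Fin n → ℝ) :
    ridgeEstimator lam (X, y) =
      WithLp.toLp 2 ((Xᵀ * X + lam • (1 : Matrix (Fin p) (Fin p) ℝ))⁻¹ *ᵥ (Xᵀ *ᵥ y)) :=
  (isMinOn_ridgeObjective_iff hlam X y _).1
    (Classical.epsilon_spec ⟨_, (isMinOn_ridgeObjective_iff hlam X y _).2 rfl⟩)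

/-- The worst-case risk of optimally tuned ridge regression,
`inf_{lam > 0} sup_{β ∈ Θ(k, τ)} 𝔼_β ‖β̂ᴿ(lam) - β‖₂²`. -/
noncomputable def ridgeOptimalRisk (n p k : ℕ) (τ σ : ℝ) : ℝ≥0∞ :=
  ⨅ (lam : ℝ) (_ : 0 < lam), supRisk k τ σ (ridgeEstimator (n := n) (p := p) lam)

/-! Write `T = k τ²`, `μ = τ/σ`, `κ = E Z⁴`. Both risks are compared with `T`, and the ridge gain
turns out smaller than the minimax gain by a factor of order `1/μ`.

Ridge gains at most `T · (k/p) μ²`. Given `X`, ridge is a linear map `M y`, so its worst risk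
dominates its average over the `p` spikes `√T e_j`, all of which lie in `Θ(k, τ)`. That average is
`(T/p) ‖M X - I‖² + σ² ‖M‖²` in Frobenius norms. Keeping only the diagonal of `M X - I` and
completing the square in `M` leaves `T - T² ‖X‖² / (p² σ²)`, and `E ‖X‖² = p`
(`linear_bayes_risk_ge`, `supRisk_ridgeEstimator_ge`). Letting the penalty tend to infinity shows
that the gain is nonnegative (`ridgeOptimalRisk_le`).

The minimax risk gains at least `T · (k/p) μ³`. The witness is `c · hardThreshold (τ/8) (Xᵀ y)` with
a small factor `c`. The support contributes a gain linear in `c`, of order `c T`. On a null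
coordinate the statistic has scale `σ`, and a fourth-moment Markov bound at level `τ/8` reduces the
cost from order `c² σ²`, which a linear rule pays, to order `c² σ⁴/τ²`. With `c = (k/p) μ³` the
total null cost is of order `c T / μ`, which is negligible (`risk_thresholdEstimator_le`,
`sparseMinimaxRisk_toReal_le`). The logarithmic bound on `μ` gives `c → 0`, and with the sample size
condition it keeps the interference `‖β‖²/n` of the other coordinates below `σ²`. -/

/-! ### Moments and linear forms of Gaussian vectors -/

theorem lintegral_le_ofReal_integral {Ω : Type*} {_ : MeasurableSpace Ω} {μ : Measure Ω}
    {f : Ω → ℝ≥0∞} {F : Ω → ℝ} (hF : Integrable F μ) (h0 : ∀ ω, 0 ≤ F ω)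
    (h : ∀ ω, f ω ≤ ENNReal.ofReal (F ω)) : ∫⁻ ω, f ω ∂μ ≤ ENNReal.ofReal (∫ ω, F ω ∂μ) := by
  rw [ofReal_integral_eq_lintegral_ofReal hF (ae_of_all _ h0)]
  exact lintegral_mono h

theorem integrable_pow_gaussianReal (v : ℝ≥0) (q : ℕ) :
    Integrable (fun x : ℝ => x ^ q) (gaussianReal 0 v) := by
  rcases Nat.eq_zero_or_pos q with rfl | hq
  · simp
  have h := (memLp_id_gaussianReal (μ := 0) (v := v) q).integrable_norm_pow hq.ne'
  exact (integrable_norm_iff (by fun_prop)).1 (by simpa using h)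

theorem integral_sq_gaussianReal (v : ℝ≥0) : ∫ x, x ^ 2 ∂gaussianReal 0 v = v := by
  have h := variance_fun_id_gaussianReal (μ := 0) (v := v)
  rw [variance_of_integral_eq_zero (by fun_prop) (by simp)] at h
  exact h

/-- The fourth moment of a standard Gaussian variable. -/
noncomputable def gaussianFourthMoment : ℝ := ∫ x, x ^ 4 ∂gaussianReal 0 1

theorem gaussianFourthMoment_nonneg : 0 ≤ gaussianFourthMoment :=
  integral_nonneg fun x => by positivity

theorem integral_pow_four_gaussianReal (v : ℝ≥0) :
    ∫ x, x ^ 4 ∂gaussianReal 0 v = gaussianFourthMoment * (v : ℝ) ^ 2 := by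
  have h : gaussianReal 0 v = (gaussianReal 0 1).map (Real.sqrt v * ·) := by
    rw [gaussianReal_map_const_mul]
    congr 1
    · simp
    · ext; simp
  rw [h, integral_map (by fun_prop) (by fun_prop)]
  have h4 : Real.sqrt v ^ 4 = (v : ℝ) ^ 2 := by
    rw [show 4 = 2 * 2 from rfl, pow_mul, Real.sq_sqrt (NNReal.coe_nonneg v)]
  simp only [mul_pow, h4, integral_const_mul, gaussianFourthMoment]
  ring

theorem iIndepFun_map_sum_gaussianReal {Ω ι : Type*} {_ : MeasurableSpace Ω} {P : Measure Ω}
    {f : ι → Ω → ℝ} {v : ι → ℝ≥0} (hind : iIndepFun f P) (hm : ∀ i, Measurable (f i))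
    (hf : ∀ i, P.map (f i) = gaussianReal 0 (v i)) (s : Finset ι) :
    P.map (∑ i ∈ s, f i) = gaussianReal 0 (∑ i ∈ s, v i) := by
  classical
  have := hind.isProbabilityMeasure
  induction s using Finset.induction_on with
  | empty =>
    simp only [Finset.sum_empty, gaussianReal_zero_var]
    change P.map (fun _ => (0 : ℝ)) = _
    simp
  | insert i s hi ih =>
    rw [Finset.sum_insert hi, Finset.sum_insert hi]
    have h := gaussianReal_add_gaussianReal_of_indepFun
      (hind.indepFun_finsetSum_of_notMem hm hi).symm ((hf i)) ih
    simpa using h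

theorem iIndepFun_pi_const_mul {ι : Type*} [Fintype ι] (v : ι → ℝ≥0) (a : ι → ℝ) :
    iIndepFun (fun i (x : ι → ℝ) => a i * x i) (Measure.pi fun i => gaussianReal 0 (v i)) :=
  iIndepFun_pi (X := fun i (x : ℝ) => a i * x) (fun i => by fun_prop)

theorem pi_gaussianReal_map_const_mul {ι : Type*} [Fintype ι] (v : ι → ℝ≥0) (a : ι → ℝ) (i : ι) :
    (Measure.pi fun i => gaussianReal 0 (v i)).map (fun x => a i * x i) =
      gaussianReal 0 (‖a i‖₊ ^ 2 * v i) := by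
  have h := (measurePreserving_eval (fun i => gaussianReal 0 (v i)) i).map_eq
  have h2 : (fun x : ι → ℝ => a i * x i) = (a i * ·) ∘ Function.eval i := rfl
  rw [h2, ← Measure.map_map (by fun_prop) (by fun_prop), h, gaussianReal_map_const_mul]
  congr 1
  · simp
  · ext; simp

theorem pi_gaussianReal_map_sum {ι : Type*} [Fintype ι] (v : ι → ℝ≥0) (a : ι → ℝ) :
    (Measure.pi fun i => gaussianReal 0 (v i)).map (fun x => ∑ i, a i * x i) =
      gaussianReal 0 (∑ i, ‖a i‖₊ ^ 2 * v i) := by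
  have h := iIndepFun_map_sum_gaussianReal (iIndepFun_pi_const_mul v a) (fun i => by fun_prop)
    (pi_gaussianReal_map_const_mul v a) Finset.univ
  rw [← h]
  congr 1
  ext x
  simp

theorem integrable_comp_pi_gaussianReal {ι : Type*} [Fintype ι] {v : ι → ℝ≥0} {a : ι → ℝ}
    {h : ℝ → ℝ} (hm : Measurable h)
    (hh : Integrable h (gaussianReal 0 (∑ i, ‖a i‖₊ ^ 2 * v i))) :
    Integrable (fun x => h (∑ i, a i * x i)) (Measure.pi fun i => gaussianReal 0 (v i)) := by
  rw [← pi_gaussianReal_map_sum] at hh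
  exact (integrable_map_measure hm.aestronglyMeasurable
    (Measurable.aemeasurable (by fun_prop))).1 hh

theorem integral_comp_pi_gaussianReal {ι : Type*} [Fintype ι] {v : ι → ℝ≥0} {a : ι → ℝ}
    {h : ℝ → ℝ} (hm : Measurable h) :
    ∫ x, h (∑ i, a i * x i) ∂(Measure.pi fun i => gaussianReal 0 (v i)) =
      ∫ x, h x ∂gaussianReal 0 (∑ i, ‖a i‖₊ ^ 2 * v i) := by
  rw [← pi_gaussianReal_map_sum, integral_map (Measurable.aemeasurable (by fun_prop))
    hm.aestronglyMeasurable]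

/-- A quadratic function is integrated against a centred Gaussian law. -/
theorem integral_quadratic_gaussianReal (v : ℝ≥0) (a b c : ℝ) :
    Integrable (fun x : ℝ => a + b * x + c * x ^ 2) (gaussianReal 0 v) ∧
      ∫ x, a + b * x + c * x ^ 2 ∂gaussianReal 0 v = a + c * v := by
  have h1 : Integrable (fun x : ℝ => x) (gaussianReal 0 v) := by
    simpa using integrable_pow_gaussianReal v 1
  have h2 := integrable_pow_gaussianReal v 2
  have h3 : Integrable (fun x : ℝ => a + b * x) (gaussianReal 0 v) :=
    (integrable_const a).add (h1.const_mul b)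
  refine ⟨h3.add (h2.const_mul c), ?_⟩
  rw [integral_add h3 (h2.const_mul c), integral_add (integrable_const a) (h1.const_mul b),
    integral_const_mul, integral_const_mul, integral_sq_gaussianReal]
  simp

/-! ### Decoupling one covariate from the rest of the response -/

/-- In one observation, the `j`-th covariate and the part of the response that does not come from
it are independent centred Gaussian variables. -/
theorem row_map (p : ℕ) (w : ℝ≥0) (σ : ℝ) (β : Fin p → ℝ) (j : Fin p) :
    ((Measure.pi fun _ : Fin p => gaussianReal 0 w).prod (gaussianReal 0 1)).map
        (fun q => (q.1 j, ∑ l ∈ Finset.univ.erase j, q.1 l * β l + σ * q.2)) =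
      (gaussianReal 0 w).prod
        (gaussianReal 0 (∑ l ∈ Finset.univ.erase j, ‖β l‖₊ ^ 2 * w + ‖σ‖₊ ^ 2)) := by
  set P := Measure.pi fun _ : Fin p => gaussianReal 0 w with hP
  -- The coefficient at `j` is reset to 1, so that `x j` itself belongs to the independent family
  -- even when `β j = 0`.
  set a : Fin p → ℝ := fun l => if l = j then 1 else β l with ha
  have hind := iIndepFun_pi_const_mul (fun _ : Fin p => w) a
  have hlaw := pi_gaussianReal_map_const_mul (fun _ : Fin p => w) a
  have hm : ∀ l, Measurable (fun x : Fin p → ℝ => a l * x l) := fun l => by fun_prop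
  set S : (Fin p → ℝ) → ℝ := ∑ l ∈ Finset.univ.erase j, fun x : Fin p → ℝ => a l * x l with hS
  have hSm : Measurable S := by
    rw [hS, Finset.sum_fn]; exact Finset.measurable_sum _ fun l _ => hm l
  have hSlaw : P.map S = gaussianReal 0 (∑ l ∈ Finset.univ.erase j, ‖β l‖₊ ^ 2 * w) := by
    rw [hS, iIndepFun_map_sum_gaussianReal hind hm hlaw]
    congr 1
    refine Finset.sum_congr rfl fun l hl => ?_
    simp [ha, Finset.ne_of_mem_erase hl]
  have hSx : ∀ x, S x = ∑ l ∈ Finset.univ.erase j, x l * β l := by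
    intro x
    rw [hS, Finset.sum_apply]
    refine Finset.sum_congr rfl fun l hl => ?_
    simp [ha, Finset.ne_of_mem_erase hl, mul_comm]
  have hj : (fun x : Fin p → ℝ => a j * x j) = fun x => x j := by
    ext x; simp [ha]
  have hIS : IndepFun (fun x : Fin p → ℝ => x j) S P := by
    have h := (hind.indepFun_finsetSum_of_notMem hm (Finset.notMem_erase j Finset.univ)).symm
    rw [hj] at h
    exact h
  have hpair : P.map (fun x => (x j, S x)) =
      (gaussianReal 0 w).prod (gaussianReal 0 (∑ l ∈ Finset.univ.erase j, ‖β l‖₊ ^ 2 * w)) := by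
    rw [(indepFun_iff_map_prod_eq_prod_map_map (measurable_pi_apply j).aemeasurable
      hSm.aemeasurable).1 hIS, hSlaw]
    congr 1
    exact (measurePreserving_eval (fun _ : Fin p => gaussianReal 0 w) j).map_eq
  have hfun : (fun q : (Fin p → ℝ) × ℝ =>
      (q.1 j, ∑ l ∈ Finset.univ.erase j, q.1 l * β l + σ * q.2)) =
      (fun r : ℝ × (ℝ × ℝ) => (r.1, r.2.1 + r.2.2)) ∘ (MeasurableEquiv.prodAssoc) ∘
        (Prod.map (fun x => (x j, S x)) (σ * ·)) := by
    ext q <;> simp [hSx, MeasurableEquiv.prodAssoc]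
  have hσ : (gaussianReal 0 1).map (σ * ·) = gaussianReal 0 (‖σ‖₊ ^ 2) := by
    rw [gaussianReal_map_const_mul]
    congr 1
    · simp
    · ext; simp
  have hm1 : Measurable (fun x : Fin p → ℝ => (x j, S x)) := by fun_prop
  have hm2 : Measurable (fun r : ℝ × (ℝ × ℝ) => (r.1, r.2.1 + r.2.2)) := by fun_prop
  rw [hfun, ← Measure.map_map hm2 (by fun_prop), ← Measure.map_map (by fun_prop) (by fun_prop),
    ← Measure.map_prod_map _ _ hm1 (by fun_prop), hpair, hσ,
    (measurePreserving_prodAssoc _ _ _).map_eq]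
  have hid : (fun r : ℝ × (ℝ × ℝ) => (r.1, r.2.1 + r.2.2)) =
    Prod.map id (fun s : ℝ × ℝ => s.1 + s.2) := rfl
  rw [hid, ← Measure.map_prod_map _ _ measurable_id (by fun_prop), Measure.map_id]
  congr 1
  have := gaussianReal_conv_gaussianReal (m₁ := 0) (m₂ := 0)
    (v₁ := ∑ l ∈ Finset.univ.erase j, ‖β l‖₊ ^ 2 * w) (v₂ := ‖σ‖₊ ^ 2)
  rw [add_zero] at this
  exact this

/-- The column `j` of the design and the part of the response that does not come from it are
independent, and both have i.i.d. centred Gaussian entries. -/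
theorem designNoiseLaw_map (n p : ℕ) (σ : ℝ) (β : Fin p → ℝ) (j : Fin p) :
    (designNoiseLaw n p).map (fun ω => (fun i => ω.1 i j,
        fun i => ∑ l ∈ Finset.univ.erase j, ω.1 i l * β l + σ * ω.2 i)) =
      (Measure.pi fun _ : Fin n => gaussianReal 0 ((n : ℝ≥0)⁻¹)).prod
        (Measure.pi fun _ : Fin n => gaussianReal 0
          (∑ l ∈ Finset.univ.erase j, ‖β l‖₊ ^ 2 * (n : ℝ≥0)⁻¹ + ‖σ‖₊ ^ 2)) := by
  set w := (n : ℝ≥0)⁻¹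
  set v := ∑ l ∈ Finset.univ.erase j, ‖β l‖₊ ^ 2 * w + ‖σ‖₊ ^ 2
  set g : (Fin p → ℝ) × ℝ → ℝ × ℝ :=
    fun q => (q.1 j, ∑ l ∈ Finset.univ.erase j, q.1 l * β l + σ * q.2) with hg
  have hgm : Measurable g := by fun_prop
  -- A pair of product measures is regrouped as a product over the observations, where the one-row
  -- statement applies to each factor.
  have e1 := measurePreserving_arrowProdEquivProdArrow (Fin p → ℝ) ℝ (Fin n)
    (fun _ => Measure.pi fun _ : Fin p => gaussianReal 0 w) (fun _ => gaussianReal 0 1)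
  have e2 := measurePreserving_arrowProdEquivProdArrow ℝ ℝ (Fin n)
    (fun _ => gaussianReal 0 w) (fun _ => gaussianReal 0 v)
  rw [← e2.map_eq, designNoiseLaw, ← e1.map_eq, ← row_map p w σ β j]
  have hpi := Measure.pi_map_pi (ι := Fin n)
    (μ := fun _ => (Measure.pi fun _ : Fin p => gaussianReal 0 w).prod (gaussianReal 0 1))
    (f := fun _ => g) (fun _ => hgm.aemeasurable)
  rw [← hpi, Measure.map_map (by fun_prop) (by fun_prop),
    Measure.map_map (by fun_prop) (by fun_prop)]
  rfl

/-! ### Hard thresholding and its risk in one coordinate -/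

/-- Hard thresholding at level `t`. -/
noncomputable def hardThreshold (t u : ℝ) : ℝ := if t < |u| then u else 0

theorem measurable_hardThreshold (t : ℝ) : Measurable (hardThreshold t) :=
  Measurable.ite (measurableSet_lt measurable_const (by fun_prop)) measurable_id measurable_const

/-- Thresholding moves `u` by at most `t`. This controls the cross term of the squared error without
any tail computation. -/
theorem mul_hardThreshold_ge (b u : ℝ) {t : ℝ} (ht : 0 ≤ t) :
    b * u - |b| * t ≤ b * hardThreshold t u := by
  unfold hardThreshold
  split_ifs with h
  · linarith [mul_nonneg (abs_nonneg b) ht]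
  · have h1 := le_abs_self (b * u)
    rw [abs_mul] at h1
    nlinarith [mul_le_mul_of_nonneg_left (not_lt.1 h) (abs_nonneg b)]

theorem hardThreshold_sq_le (t u : ℝ) : hardThreshold t u ^ 2 ≤ u ^ 2 := by
  unfold hardThreshold
  split_ifs
  · exact le_rfl
  · simpa using sq_nonneg u

/-- Pointwise Markov inequality: where the output is nonzero, `u²/t² ≥ 1`. It is the source of the
advantage over linear rules on null coordinates. -/
theorem hardThreshold_sq_le_pow_four {t : ℝ} (ht : 0 < t) (u : ℝ) :
    hardThreshold t u ^ 2 ≤ u ^ 4 / t ^ 2 := by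
  unfold hardThreshold
  split_ifs with h
  · rw [le_div_iff₀ (by positivity)]
    have h1 : t ^ 2 ≤ u ^ 2 := by
      rw [← sq_abs u]
      exact pow_le_pow_left₀ ht.le h.le 2
    nlinarith [sq_nonneg u]
  · rw [zero_pow two_ne_zero]
    positivity

section Column

variable {n : ℕ}

theorem integral_sum_sq_pi_gaussianReal (hn : 0 < n) :
    Integrable (fun a : Fin n → ℝ => ∑ i, a i ^ 2)
        (Measure.pi fun _ : Fin n => gaussianReal 0 ((n : ℝ≥0)⁻¹)) ∧
      ∫ a, ∑ i, a i ^ 2 ∂(Measure.pi fun _ : Fin n => gaussianReal 0 ((n : ℝ≥0)⁻¹)) = 1 := by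
  have hi : ∀ i : Fin n, Integrable (fun a : Fin n → ℝ => a i ^ 2)
      (Measure.pi fun _ : Fin n => gaussianReal 0 ((n : ℝ≥0)⁻¹)) := fun i =>
    integrable_comp_eval (μ := fun _ : Fin n => gaussianReal 0 ((n : ℝ≥0)⁻¹)) (i := i)
      (f := fun x : ℝ => x ^ 2) (integrable_pow_gaussianReal _ 2)
  refine ⟨integrable_finsetSum _ fun i _ => hi i, ?_⟩
  rw [integral_finsetSum _ fun i _ => hi i]
  have h : ∀ i : Fin n, ∫ a : Fin n → ℝ, a i ^ 2
      ∂(Measure.pi fun _ : Fin n => gaussianReal 0 ((n : ℝ≥0)⁻¹)) = (n : ℝ)⁻¹ := fun i => by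
    rw [integral_comp_eval (μ := fun _ : Fin n => gaussianReal 0 ((n : ℝ≥0)⁻¹)) (i := i)
      (f := fun x : ℝ => x ^ 2) (by fun_prop), integral_sq_gaussianReal]
    simp
  simp only [h, Finset.sum_const, Finset.card_univ, Fintype.card_fin, nsmul_eq_mul]
  field_simp

/-- Cauchy–Schwarz, `(∑ aᵢ²)² ≤ n ∑ aᵢ⁴`, where each fourth moment is `κ/n²`. Only uniformity in `n`
matters, so the value of `κ` is never needed. -/
theorem integral_sum_sq_sq_pi_gaussianReal_le (hn : 0 < n) :
    Integrable (fun a : Fin n → ℝ => (∑ i, a i ^ 2) ^ 2)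
        (Measure.pi fun _ : Fin n => gaussianReal 0 ((n : ℝ≥0)⁻¹)) ∧
      ∫ a, (∑ i, a i ^ 2) ^ 2 ∂(Measure.pi fun _ : Fin n => gaussianReal 0 ((n : ℝ≥0)⁻¹)) ≤
        gaussianFourthMoment := by
  have hi : ∀ i : Fin n, Integrable (fun a : Fin n → ℝ => a i ^ 4)
      (Measure.pi fun _ : Fin n => gaussianReal 0 ((n : ℝ≥0)⁻¹)) := fun i =>
    integrable_comp_eval (μ := fun _ : Fin n => gaussianReal 0 ((n : ℝ≥0)⁻¹)) (i := i)
      (f := fun x : ℝ => x ^ 4) (integrable_pow_gaussianReal _ 4)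
  have hle : ∀ a : Fin n → ℝ, (∑ i, a i ^ 2) ^ 2 ≤ n * ∑ i, a i ^ 4 := fun a => by
    have h := sq_sum_le_card_mul_sum_sq (s := Finset.univ) (f := fun i => a i ^ 2)
    simpa [← pow_mul] using h
  have hint : Integrable (fun a : Fin n → ℝ => n * ∑ i, a i ^ 4)
      (Measure.pi fun _ : Fin n => gaussianReal 0 ((n : ℝ≥0)⁻¹)) :=
    (integrable_finsetSum _ fun i _ => hi i).const_mul _
  have hint2 : Integrable (fun a : Fin n → ℝ => (∑ i, a i ^ 2) ^ 2)
        (Measure.pi fun _ : Fin n => gaussianReal 0 ((n : ℝ≥0)⁻¹)) :=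
    hint.mono' (Measurable.aestronglyMeasurable (by fun_prop)) (ae_of_all _ fun a => by
      rw [Real.norm_of_nonneg (by positivity)]
      exact hle a)
  refine ⟨hint2, (integral_mono hint2 hint hle).trans ?_⟩
  rw [integral_const_mul, integral_finsetSum _ fun i _ => hi i]
  have h : ∀ i : Fin n, ∫ a : Fin n → ℝ, a i ^ 4
      ∂(Measure.pi fun _ : Fin n => gaussianReal 0 ((n : ℝ≥0)⁻¹)) =
        gaussianFourthMoment * (n : ℝ)⁻¹ ^ 2 := fun i => by
    rw [integral_comp_eval (μ := fun _ : Fin n => gaussianReal 0 ((n : ℝ≥0)⁻¹)) (i := i)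
      (f := fun x : ℝ => x ^ 4) (by fun_prop), integral_pow_four_gaussianReal]
    simp
  simp only [h, Finset.sum_const, Finset.card_univ, Fintype.card_fin, nsmul_eq_mul]
  field_simp
  exact le_rfl

theorem coe_sum_nnnorm_sq_mul (a : Fin n → ℝ) (v : ℝ≥0) :
    ((∑ i, ‖a i‖₊ ^ 2 * v : ℝ≥0) : ℝ) = (∑ i, a i ^ 2) * v := by
  push_cast
  simp [Finset.sum_mul]

theorem correlation_eq (b : ℝ) (a r : Fin n → ℝ) :
    ∑ i, a i * (b * a i + r i) = b * ∑ i, a i ^ 2 + ∑ i, a i * r i := by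
  rw [Finset.mul_sum, ← Finset.sum_add_distrib]
  exact Finset.sum_congr rfl fun i _ => by ring

/-- The squared error is dominated by a quadratic in the statistic `u`. Given the column `a`, `u` is
Gaussian with mean `b ∑ aᵢ²` and variance `v ∑ aᵢ²`, so only the first two moments of `∑ aᵢ²` enter.
-/
theorem lintegral_threshold_le (hn : 0 < n) (v : ℝ≥0) (b : ℝ) {c t : ℝ} (hc : 0 ≤ c) (ht : 0 ≤ t) :
    ∫⁻ q, ENNReal.ofReal ((c * hardThreshold t (∑ i, q.1 i * (b * q.1 i + q.2 i)) - b) ^ 2)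
        ∂((Measure.pi fun _ : Fin n => gaussianReal 0 ((n : ℝ≥0)⁻¹)).prod
          (Measure.pi fun _ : Fin n => gaussianReal 0 v)) ≤
      ENNReal.ofReal (b ^ 2 - 2 * c * b ^ 2 + 2 * c * |b| * t +
        c ^ 2 * (gaussianFourthMoment * b ^ 2 + v)) := by
  obtain ⟨hA, hA1⟩ := integral_sum_sq_pi_gaussianReal hn
  obtain ⟨hAA, hAA1⟩ := integral_sum_sq_sq_pi_gaussianReal_le hn
  set Pa := Measure.pi fun _ : Fin n => gaussianReal 0 ((n : ℝ≥0)⁻¹) with hPa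
  set Pr := Measure.pi fun _ : Fin n => gaussianReal 0 v
  set d : ℝ := b ^ 2 + 2 * c * |b| * t with hd
  have hbound : ∀ u : ℝ, (c * hardThreshold t u - b) ^ 2 ≤ d - 2 * c * b * u + c ^ 2 * u ^ 2 := by
    intro u
    have h1 := mul_le_mul_of_nonneg_left (mul_hardThreshold_ge b u ht) hc
    have h2 := mul_le_mul_of_nonneg_left (hardThreshold_sq_le t u) (sq_nonneg c)
    rw [hd]
    nlinarith
  have hinner : ∀ a : Fin n → ℝ,
      ∫⁻ r, ENNReal.ofReal ((c * hardThreshold t (∑ i, a i * (b * a i + r i)) - b) ^ 2) ∂Pr ≤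
        ENNReal.ofReal (d - 2 * c * b ^ 2 * (∑ i, a i ^ 2) +
          c ^ 2 * (b ^ 2 * (∑ i, a i ^ 2) ^ 2 + (∑ i, a i ^ 2) * v)) ∧
      0 ≤ d - 2 * c * b ^ 2 * (∑ i, a i ^ 2) +
          c ^ 2 * (b ^ 2 * (∑ i, a i ^ 2) ^ 2 + (∑ i, a i ^ 2) * v) := by
    intro a
    set A := ∑ i, a i ^ 2 with hAdef
    obtain ⟨hq1, hq2⟩ := integral_quadratic_gaussianReal (∑ i, ‖a i‖₊ ^ 2 * v)
      (d - 2 * c * b ^ 2 * A + c ^ 2 * (b * A) ^ 2) (-(2 * c * b) + 2 * c ^ 2 * (b * A)) (c ^ 2)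
    set h : ℝ → ℝ := fun x => d - 2 * c * b ^ 2 * A + c ^ 2 * (b * A) ^ 2 +
      (-(2 * c * b) + 2 * c ^ 2 * (b * A)) * x + c ^ 2 * x ^ 2 with hh
    have hm : Measurable h := by fun_prop
    have hle : ∀ r : Fin n → ℝ,
        (c * hardThreshold t (∑ i, a i * (b * a i + r i)) - b) ^ 2 ≤ h (∑ i, a i * r i) := by
      intro r
      refine (hbound _).trans (le_of_eq ?_)
      rw [correlation_eq, hh]
      ring
    have hval : ∫ r, h (∑ i, a i * r i) ∂Pr = d - 2 * c * b ^ 2 * A +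
          c ^ 2 * (b ^ 2 * A ^ 2 + A * v) := by
      rw [integral_comp_pi_gaussianReal hm, hq2, coe_sum_nnnorm_sq_mul]
      ring
    have h0 : ∀ r : Fin n → ℝ, 0 ≤ h (∑ i, a i * r i) := fun r => (sq_nonneg _).trans (hle r)
    rw [← hval]
    exact ⟨lintegral_le_ofReal_integral (integrable_comp_pi_gaussianReal hm hq1) h0
      fun r => ENNReal.ofReal_le_ofReal (hle r), integral_nonneg h0⟩
  have hint : Integrable (fun a : Fin n → ℝ => d - 2 * c * b ^ 2 * (∑ i, a i ^ 2) +
      c ^ 2 * (b ^ 2 * (∑ i, a i ^ 2) ^ 2 + (∑ i, a i ^ 2) * v)) Pa :=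
    ((integrable_const d).sub (hA.const_mul _)).add
      (((hAA.const_mul _).add (hA.mul_const _)).const_mul _)
  refine (lintegral_prod_le _).trans ((lintegral_le_ofReal_integral hint (fun a => (hinner a).2)
    fun a => (hinner a).1).trans (ENNReal.ofReal_le_ofReal ?_))
  have i1 : Integrable (fun a : Fin n → ℝ => d - 2 * c * b ^ 2 * (∑ i, a i ^ 2)) Pa :=
    (integrable_const d).sub (hA.const_mul _)
  have i2 : Integrable (fun a : Fin n → ℝ =>
      b ^ 2 * (∑ i, a i ^ 2) ^ 2 + (∑ i, a i ^ 2) * v) Pa :=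
    (hAA.const_mul _).add (hA.mul_const _)
  rw [integral_add i1 (i2.const_mul _), integral_sub (integrable_const d) (hA.const_mul _),
    integral_const_mul, integral_const_mul,
    integral_add (hAA.const_mul _) (hA.mul_const _), integral_const_mul, integral_mul_const, hA1]
  have h3 := mul_le_mul_of_nonneg_left hAA1 (mul_nonneg (sq_nonneg c) (sq_nonneg b))
  simp only [integral_const, probReal_univ, smul_eq_mul, one_mul]
  rw [hd]
  nlinarith

/-- One factor `κ` comes from the fourth moment of the noise given the column, the other from the
second moment of the squared column norm. -/
theorem lintegral_threshold_null_le (hn : 0 < n) (v : ℝ≥0) (c : ℝ) {t : ℝ} (ht : 0 < t) :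
    ∫⁻ q, ENNReal.ofReal ((c * hardThreshold t (∑ i, q.1 i * q.2 i)) ^ 2)
        ∂((Measure.pi fun _ : Fin n => gaussianReal 0 ((n : ℝ≥0)⁻¹)).prod
          (Measure.pi fun _ : Fin n => gaussianReal 0 v)) ≤
      ENNReal.ofReal (c ^ 2 * (gaussianFourthMoment ^ 2 * v ^ 2 / t ^ 2)) := by
  obtain ⟨hAA, hAA1⟩ := integral_sum_sq_sq_pi_gaussianReal_le hn
  set Pa := Measure.pi fun _ : Fin n => gaussianReal 0 ((n : ℝ≥0)⁻¹) with hPa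
  set Pr := Measure.pi fun _ : Fin n => gaussianReal 0 v
  have hκ := gaussianFourthMoment_nonneg
  have hinner : ∀ a : Fin n → ℝ,
      ∫⁻ r, ENNReal.ofReal ((c * hardThreshold t (∑ i, a i * r i)) ^ 2) ∂Pr ≤
        ENNReal.ofReal (c ^ 2 / t ^ 2 * (gaussianFourthMoment * v ^ 2) * (∑ i, a i ^ 2) ^ 2) := by
    intro a
    set h : ℝ → ℝ := fun x => c ^ 2 / t ^ 2 * x ^ 4 with hh
    have hm : Measurable h := by fun_prop
    have hval : ∫ r, h (∑ i, a i * r i) ∂Pr =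
        c ^ 2 / t ^ 2 * (gaussianFourthMoment * v ^ 2) * (∑ i, a i ^ 2) ^ 2 := by
      rw [integral_comp_pi_gaussianReal hm, hh, integral_const_mul,
        integral_pow_four_gaussianReal, coe_sum_nnnorm_sq_mul]
      ring
    rw [← hval]
    refine lintegral_le_ofReal_integral (integrable_comp_pi_gaussianReal hm
      ((integrable_pow_gaussianReal _ 4).const_mul _)) (fun r => by positivity)
      fun r => ENNReal.ofReal_le_ofReal ?_
    have h2 := mul_le_mul_of_nonneg_left
      (hardThreshold_sq_le_pow_four ht (∑ i, a i * r i)) (sq_nonneg c)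
    rw [mul_pow, hh]
    refine h2.trans (le_of_eq (by ring))
  refine (lintegral_prod_le _).trans ((lintegral_le_ofReal_integral (hAA.const_mul _)
    (fun a => by positivity) hinner).trans (ENNReal.ofReal_le_ofReal ?_))
  rw [integral_const_mul]
  refine (mul_le_mul_of_nonneg_left hAA1 (by positivity)).trans (le_of_eq ?_)
  ring

end Column

/-! ### Upper bound for the minimax risk by shrunken thresholding -/

/-- The separable estimator `c · hardThreshold t (Xᵀy)`. -/
noncomputable def thresholdEstimator {n p : ℕ} (c t : ℝ)
    (data : (Fin n → Fin p → ℝ) × (Fin n → ℝ)) : EuclideanSpace ℝ (Fin p) :=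
  WithLp.toLp 2 fun j => c * hardThreshold t (∑ i, data.1 i j * data.2 i)

theorem measurable_thresholdEstimator {n p : ℕ} (c t : ℝ) :
    Measurable (thresholdEstimator (n := n) (p := p) c t) := by
  refine (WithLp.measurable_toLp 2 (Fin p → ℝ)).comp (measurable_pi_lambda _ fun j => ?_)
  have h : Measurable fun data : (Fin n → Fin p → ℝ) × (Fin n → ℝ) =>
      ∑ i, data.1 i j * data.2 i := by fun_prop
  exact ((measurable_hardThreshold t).comp h).const_mul c

theorem measurable_response {n p : ℕ} (σ : ℝ) (β : EuclideanSpace ℝ (Fin p)) :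
    Measurable fun ω : (Fin n → Fin p → ℝ) × (Fin n → ℝ) => (ω.1, response σ β ω.1 ω.2) := by
  unfold response
  fun_prop

theorem lintegral_thresholdEstimator_coord {n p : ℕ} (σ c t : ℝ) (β : EuclideanSpace ℝ (Fin p))
    (j : Fin p) :
    ∫⁻ ω, ENNReal.ofReal ((thresholdEstimator c t (ω.1, response σ β ω.1 ω.2) j - β j) ^ 2)
        ∂(designNoiseLaw n p) =
      ∫⁻ q, ENNReal.ofReal ((c * hardThreshold t (∑ i, q.1 i * (β j * q.1 i + q.2 i)) - β j) ^ 2)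
        ∂((Measure.pi fun _ : Fin n => gaussianReal 0 ((n : ℝ≥0)⁻¹)).prod
          (Measure.pi fun _ : Fin n => gaussianReal 0
            (∑ l ∈ Finset.univ.erase j, ‖β l‖₊ ^ 2 * (n : ℝ≥0)⁻¹ + ‖σ‖₊ ^ 2))) := by
  have hg := measurable_hardThreshold t
  have h1 : Measurable fun q : (Fin n → ℝ) × (Fin n → ℝ) =>
      ENNReal.ofReal ((c * hardThreshold t (∑ i, q.1 i * (β j * q.1 i + q.2 i)) - β j) ^ 2) := by
    fun_prop
  rw [← designNoiseLaw_map n p σ β j, lintegral_map h1 (by fun_prop)]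
  refine lintegral_congr fun ω => ?_
  simp only [thresholdEstimator]
  congr 5
  refine Finset.sum_congr rfl fun i _ => ?_
  rw [response, ← Finset.add_sum_erase _ _ (Finset.mem_univ j)]
  ring

theorem coe_residual_variance_le {n p : ℕ} (σ : ℝ) (β : EuclideanSpace ℝ (Fin p)) (j : Fin p) :
    ((∑ l ∈ Finset.univ.erase j, ‖β l‖₊ ^ 2 * (n : ℝ≥0)⁻¹ + ‖σ‖₊ ^ 2 : ℝ≥0) : ℝ) ≤
      ‖β‖ ^ 2 / n + σ ^ 2 := by
  push_cast
  rw [EuclideanSpace.real_norm_sq_eq, Finset.sum_div]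
  simp only [Real.norm_eq_abs, sq_abs]
  refine add_le_add (Finset.sum_le_sum_of_subset_of_nonneg (Finset.erase_subset _ _)
    fun l _ _ => by positivity) le_rfl

theorem lintegral_thresholdEstimator_coord_le {n p : ℕ} (hn : 0 < n) {σ c τ V : ℝ} (hc : 0 ≤ c)
    (hτ : 0 < τ) (β : EuclideanSpace ℝ (Fin p)) (hV : ‖β‖ ^ 2 / n + σ ^ 2 ≤ V) (j : Fin p) :
    ∫⁻ ω, ENNReal.ofReal ((thresholdEstimator c (τ / 8) (ω.1, response σ β ω.1 ω.2) j - β j) ^ 2)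
        ∂(designNoiseLaw n p) ≤
      ENNReal.ofReal (β j ^ 2 * (1 - 15 / 8 * c + c ^ 2 * gaussianFourthMoment) +
        (if β j ≠ 0 then c * τ ^ 2 / 8 + c ^ 2 * V else 0) +
        c ^ 2 * (64 * gaussianFourthMoment ^ 2 * V ^ 2 / τ ^ 2)) := by
  rw [lintegral_thresholdEstimator_coord]
  have hv := (coe_residual_variance_le (n := n) σ β j).trans hV
  set v := ∑ l ∈ Finset.univ.erase j, ‖β l‖₊ ^ 2 * (n : ℝ≥0)⁻¹ + ‖σ‖₊ ^ 2
  have hv0 : (0 : ℝ) ≤ v := NNReal.coe_nonneg v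
  by_cases hb : β j = 0
  · simp only [hb, zero_mul, zero_add, sub_zero]
    refine (lintegral_threshold_null_le hn v c (by positivity)).trans (ENNReal.ofReal_le_ofReal ?_)
    have h1 : (v : ℝ) ^ 2 ≤ V ^ 2 := pow_le_pow_left₀ hv0 hv 2
    have h2 : gaussianFourthMoment ^ 2 * (v : ℝ) ^ 2 / (τ / 8) ^ 2 =
      64 * gaussianFourthMoment ^ 2 * (v : ℝ) ^ 2 / τ ^ 2 := by field_simp; ring
    rw [h2]
    simp only [ne_eq, not_true_eq_false, if_false]
    have h3 : 64 * gaussianFourthMoment ^ 2 * (v : ℝ) ^ 2 / τ ^ 2 ≤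
      64 * gaussianFourthMoment ^ 2 * V ^ 2 / τ ^ 2 := by gcongr
    nlinarith [mul_le_mul_of_nonneg_left h3 (sq_nonneg c)]
  · refine (lintegral_threshold_le hn v (β j) hc (t := τ / 8) (by positivity)).trans
      (ENNReal.ofReal_le_ofReal ?_)
    rw [if_pos hb]
    have h1 : 0 ≤ c ^ 2 * (64 * gaussianFourthMoment ^ 2 * V ^ 2 / τ ^ 2) := by positivity
    have h2 := mul_le_mul_of_nonneg_left hv (sq_nonneg c)
    -- At level `τ/8` the threshold bias `2c|β j|τ/8` splits into `c β j²/8`, which turns `2c` into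
    -- `15c/8`, and `c τ²/8` per support coordinate.
    have h3 : 2 * |β j| * τ ≤ β j ^ 2 + τ ^ 2 := by
      rw [← sq_abs (β j)]; nlinarith [sq_nonneg (|β j| - τ)]
    nlinarith [mul_le_mul_of_nonneg_left h3 hc]

/-- Sum of the coordinate bounds with residual variance at most `2σ²`. The at most `k` support terms
`c τ²/8` lower the gain from `15c/8` to `7c/4`. The bound `c ≤ 1/2` keeps the coefficient of `‖β‖²`
nonnegative, so that `‖β‖² ≤ k τ²` can be inserted. -/
theorem risk_thresholdEstimator_le {n p k : ℕ} (hn : 0 < n) {σ c τ : ℝ} (hc : 0 ≤ c)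
    (hc2 : c ≤ 1 / 2) (hτ : 0 < τ) (hkn : k * τ ^ 2 / n ≤ σ ^ 2) {β : EuclideanSpace ℝ (Fin p)}
    (hβ : β ∈ paramSpace p k τ) :
    risk (n := n) σ (thresholdEstimator c (τ / 8)) β ≤
      ENNReal.ofReal (k * τ ^ 2 * (1 - 7 / 4 * c + c ^ 2 * gaussianFourthMoment) +
        2 * k * c ^ 2 * σ ^ 2 +
        256 * gaussianFourthMoment ^ 2 * p * c ^ 2 * σ ^ 4 / τ ^ 2) := by
  obtain ⟨hβ1, hβ2⟩ := hβ
  have hκ := gaussianFourthMoment_nonneg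
  have hV : ‖β‖ ^ 2 / n + σ ^ 2 ≤ 2 * σ ^ 2 := by
    have : ‖β‖ ^ 2 / n ≤ k * τ ^ 2 / n := by gcongr
    linarith
  have hmeas : ∀ j : Fin p, Measurable fun ω : (Fin n → Fin p → ℝ) × (Fin n → ℝ) =>
      ENNReal.ofReal ((thresholdEstimator c (τ / 8) (ω.1, response σ β ω.1 ω.2) j - β j) ^ 2) := by
    intro j
    have h := (measurable_thresholdEstimator (n := n) (p := p) c (τ / 8)).comp
      (measurable_response σ β)
    have h' : Measurable fun ω : (Fin n → Fin p → ℝ) × (Fin n → ℝ) =>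
      thresholdEstimator c (τ / 8) (ω.1, response σ β ω.1 ω.2) j :=
      (measurable_pi_apply j).comp ((WithLp.measurable_ofLp 2 _).comp h)
    fun_prop
  have hpos : ∀ j : Fin p, 0 ≤ β j ^ 2 * (1 - 15 / 8 * c + c ^ 2 * gaussianFourthMoment) +
        (if β j ≠ 0 then c * τ ^ 2 / 8 + c ^ 2 * (2 * σ ^ 2) else 0) +
        c ^ 2 * (64 * gaussianFourthMoment ^ 2 * (2 * σ ^ 2) ^ 2 / τ ^ 2) := by
    intro j
    have h1 : 0 ≤ 1 - 15 / 8 * c + c ^ 2 * gaussianFourthMoment := by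
      have : 0 ≤ c ^ 2 * gaussianFourthMoment := by positivity
      linarith
    have h2 : 0 ≤ (if β j ≠ 0 then c * τ ^ 2 / 8 + c ^ 2 * (2 * σ ^ 2) else 0) := by
      split_ifs <;> positivity
    positivity
  rw [risk]
  simp only [EuclideanSpace.real_norm_sq_eq, PiLp.sub_apply]
  simp_rw [ENNReal.ofReal_sum_of_nonneg fun j _ => sq_nonneg _]
  rw [lintegral_finsetSum _ fun j _ => hmeas j]
  refine (Finset.sum_le_sum fun j _ =>
    lintegral_thresholdEstimator_coord_le hn hc hτ β hV j).trans ?_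
  rw [← ENNReal.ofReal_sum_of_nonneg fun j _ => hpos j]
  refine ENNReal.ofReal_le_ofReal ?_
  rw [Finset.sum_add_distrib, Finset.sum_add_distrib, ← Finset.sum_mul,
    ← EuclideanSpace.real_norm_sq_eq, ← Finset.sum_filter, Finset.sum_const, Finset.sum_const,
    Finset.card_univ, Fintype.card_fin]
  have hcard : (((Finset.univ.filter fun j => β j ≠ 0).card : ℕ) : ℝ) ≤ k := by
    rw [Set.ncard_eq_toFinset_card'] at hβ1
    simp only [Set.toFinset_ofPred] at hβ1
    exact_mod_cast hβ1
  simp only [nsmul_eq_mul]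
  have h1 : 0 ≤ 1 - 15 / 8 * c + c ^ 2 * gaussianFourthMoment := by
    have : 0 ≤ c ^ 2 * gaussianFourthMoment := by positivity
    linarith
  have h2 := mul_le_mul_of_nonneg_right hβ2 h1
  have h3 : 0 ≤ c * τ ^ 2 / 8 + c ^ 2 * (2 * σ ^ 2) := by positivity
  have h4 := mul_le_mul_of_nonneg_right hcard h3
  have h5 : (p : ℝ) * (c ^ 2 * (64 * gaussianFourthMoment ^ 2 * (2 * σ ^ 2) ^ 2 / τ ^ 2)) =
    256 * gaussianFourthMoment ^ 2 * p * c ^ 2 * σ ^ 4 / τ ^ 2 := by ring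
  rw [h5]
  linarith

theorem sparseMinimaxRisk_le {n p k : ℕ} (hn : 0 < n) {σ c τ : ℝ} (hc : 0 ≤ c)
    (hc2 : c ≤ 1 / 2) (hτ : 0 < τ) (hkn : k * τ ^ 2 / n ≤ σ ^ 2) :
    sparseMinimaxRisk n p k τ σ ≤
      ENNReal.ofReal (k * τ ^ 2 * (1 - 7 / 4 * c + c ^ 2 * gaussianFourthMoment) +
        2 * k * c ^ 2 * σ ^ 2 +
        256 * gaussianFourthMoment ^ 2 * p * c ^ 2 * σ ^ 4 / τ ^ 2) :=
  (iInf₂_le _ (measurable_thresholdEstimator c (τ / 8))).trans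
    (iSup₂_le fun _ hβ => risk_thresholdEstimator_le hn hc hc2 hτ hkn hβ)

/-! ### Lower bound for ridge by averaging over spikes -/

theorem ofReal_integral_le_lintegral_ofReal {Ω : Type*} {_ : MeasurableSpace Ω} {μ : Measure Ω}
    {f : Ω → ℝ} (hf : Integrable f μ) :
    ENNReal.ofReal (∫ ω, f ω ∂μ) ≤ ∫⁻ ω, ENNReal.ofReal (f ω) ∂μ := by
  have h : ∫ ω, f ω ∂μ ≤ ∫ ω, max (f ω) 0 ∂μ :=
    integral_mono hf hf.pos_part fun ω => le_max_left _ _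
  refine (ENNReal.ofReal_le_ofReal h).trans (le_of_eq ?_)
  rw [ofReal_integral_eq_lintegral_ofReal hf.pos_part (ae_of_all _ fun ω => le_max_right _ _)]
  refine lintegral_congr fun ω => ?_
  simp

/-- Mean squared norm of an affine image of a standard Gaussian vector. -/
theorem lintegral_norm_sq_affine {n p : ℕ} (w : Fin p → ℝ) (M : Matrix (Fin p) (Fin n) ℝ) :
    ∫⁻ z, ENNReal.ofReal (∑ l, (w l + ∑ i, M l i * z i) ^ 2)
        ∂(Measure.pi fun _ : Fin n => gaussianReal 0 1) =
      ENNReal.ofReal (∑ l, (w l ^ 2 + ∑ i, M l i ^ 2)) := by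
  set P := Measure.pi fun _ : Fin n => gaussianReal 0 1 with hP
  have key : ∀ l, Integrable (fun z : Fin n → ℝ => (w l + ∑ i, M l i * z i) ^ 2) P ∧
      ∫ z, (w l + ∑ i, M l i * z i) ^ 2 ∂P = w l ^ 2 + ∑ i, M l i ^ 2 := by
    intro l
    obtain ⟨h1, h2⟩ := integral_quadratic_gaussianReal (∑ i, ‖M l i‖₊ ^ 2 * 1)
      (w l ^ 2) (2 * w l) 1
    have hm : Measurable fun x : ℝ => w l ^ 2 + 2 * w l * x + 1 * x ^ 2 := by fun_prop
    have e : (fun z : Fin n → ℝ => (w l + ∑ i, M l i * z i) ^ 2) =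
        fun z => w l ^ 2 + 2 * w l * (∑ i, M l i * z i) + 1 * (∑ i, M l i * z i) ^ 2 := by
      ext z; ring
    rw [e]
    refine ⟨integrable_comp_pi_gaussianReal (v := fun _ => 1) (a := M l) hm h1, ?_⟩
    rw [hP, integral_comp_pi_gaussianReal (v := fun _ => 1) (a := M l) hm, h2,
      coe_sum_nnnorm_sq_mul]
    simp
  rw [← ofReal_integral_eq_lintegral_ofReal (integrable_finsetSum _ fun l _ => (key l).1)
    (ae_of_all _ fun z => Finset.sum_nonneg fun l _ => sq_nonneg _),
    integral_finsetSum _ fun l _ => (key l).1]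
  simp only [(key _).2]

/-- The matrix of the ridge estimator, `(XᵀX + lam I)⁻¹ Xᵀ`. -/
noncomputable def ridgeMatrix {n p : ℕ} (lam : ℝ) (X : Matrix (Fin n) (Fin p) ℝ) :
    Matrix (Fin p) (Fin n) ℝ :=
  (Xᵀ * X + lam • (1 : Matrix (Fin p) (Fin p) ℝ))⁻¹ * Xᵀ

section Ridge

variable {n p : ℕ}

/-- By Cramer's rule each entry is a polynomial in `X` divided by a determinant. -/
theorem measurable_ridgeMatrix (lam : ℝ) (l : Fin p) (i : Fin n) :
    Measurable fun X : Fin n → Fin p → ℝ => ridgeMatrix lam (Matrix.of X) l i := by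
  have hof : Continuous fun X : Fin n → Fin p → ℝ => Matrix.of X := continuous_id
  have hc : Continuous fun X : Fin n → Fin p → ℝ =>
      (Matrix.of X)ᵀ * Matrix.of X + lam • (1 : Matrix (Fin p) (Fin p) ℝ) :=
    (hof.matrix_transpose.matrix_mul hof).add continuous_const
  have h1 := hc.matrix_det.measurable.inv
  have h2 := ((hc.matrix_adjugate.matrix_mul hof.matrix_transpose).matrix_elem l i).measurable
  convert h1.mul h2 using 2 with X
  rw [ridgeMatrix, Matrix.inv_def, Ring.inverse_eq_inv', Matrix.smul_mul, Matrix.smul_apply,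
    smul_eq_mul]
  rfl

theorem measurable_ridge_bias (lam : ℝ) (b : Fin p → ℝ) (l : Fin p) :
    Measurable fun X : Fin n → Fin p → ℝ =>
      ((ridgeMatrix lam (Matrix.of X) * Matrix.of X - 1) *ᵥ b) l := by
  simp only [Matrix.mulVec, dotProduct, Matrix.sub_apply, Matrix.mul_apply, Matrix.of_apply]
  refine Finset.measurable_sum _ fun j _ => Measurable.mul_const (Measurable.sub_const
    (Finset.measurable_sum _ fun i _ => (measurable_ridgeMatrix lam l i).mul ?_) _) _
  fun_prop

/-- The error of ridge regression is affine in the noise. -/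
theorem ridgeEstimator_response_sub {lam : ℝ} (hlam : 0 < lam) (σ : ℝ)
    (β : EuclideanSpace ℝ (Fin p)) (X : Matrix (Fin n) (Fin p) ℝ) (z : Fin n → ℝ) (l : Fin p) :
    (ridgeEstimator lam (X, response σ β X z) - β) l =
      ((ridgeMatrix lam X * X - 1) *ᵥ β.ofLp) l + ∑ i, (σ • ridgeMatrix lam X) l i * z i := by
  have hr : response σ β X z = X *ᵥ β.ofLp + σ • z := rfl
  have hs : ∑ i, (σ • ridgeMatrix lam X) l i * z i = ((σ • ridgeMatrix lam X) *ᵥ z) l := rfl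
  rw [ridgeEstimator_eq hlam, hs, hr, Matrix.mulVec_mulVec]
  change ((ridgeMatrix lam X *ᵥ (X *ᵥ β.ofLp + σ • z)) l - β l) = _
  rw [Matrix.mulVec_add, Matrix.mulVec_mulVec, Matrix.sub_mulVec, Matrix.one_mulVec,
    Matrix.mulVec_smul, Matrix.smul_mulVec]
  simp only [Pi.add_apply, Pi.sub_apply]
  ring

theorem risk_ridgeEstimator {lam : ℝ} (hlam : 0 < lam) (σ : ℝ) (β : EuclideanSpace ℝ (Fin p)) :
    risk (n := n) σ (ridgeEstimator lam) β =
      ∫⁻ X : Fin n → Fin p → ℝ, ENNReal.ofReal (∑ l,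
        ((((ridgeMatrix lam (Matrix.of X) * Matrix.of X - 1) *ᵥ β.ofLp) l) ^ 2 +
        ∑ i, ((σ • ridgeMatrix lam (Matrix.of X)) l i) ^ 2))
        ∂(Measure.pi fun _ : Fin n => Measure.pi fun _ : Fin p =>
          gaussianReal 0 ((n : ℝ≥0)⁻¹)) := by
  have hm := measurable_ridgeMatrix (n := n) (p := p) lam
  have e : ∀ ω : (Fin n → Fin p → ℝ) × (Fin n → ℝ),
      ‖ridgeEstimator lam (ω.1, response σ β ω.1 ω.2) - β‖ ^ 2 =
      ∑ l, (((ridgeMatrix lam (Matrix.of ω.1) * Matrix.of ω.1 - 1) *ᵥ β.ofLp) l +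
        ∑ i, (σ • ridgeMatrix lam (Matrix.of ω.1)) l i * ω.2 i) ^ 2 := by
    intro ω
    rw [EuclideanSpace.real_norm_sq_eq]
    exact Finset.sum_congr rfl fun l _ => congrArg (· ^ 2)
      (ridgeEstimator_response_sub hlam σ β (Matrix.of ω.1) ω.2 l)
  have hmeas : Measurable fun ω : (Fin n → Fin p → ℝ) × (Fin n → ℝ) =>
      ∑ l, (((ridgeMatrix lam (Matrix.of ω.1) * Matrix.of ω.1 - 1) *ᵥ β.ofLp) l +
        ∑ i, (σ • ridgeMatrix lam (Matrix.of ω.1)) l i * ω.2 i) ^ 2 := by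
    refine Finset.measurable_sum _ fun l _ => Measurable.pow_const (Measurable.add
      ((measurable_ridge_bias lam _ l).comp measurable_fst)
      (Finset.measurable_sum _ fun i _ => Measurable.mul ?_ (by fun_prop))) 2
    exact ((hm l i).comp measurable_fst).const_mul σ
  rw [risk]
  simp only [e]
  rw [designNoiseLaw, lintegral_prod _ hmeas.ennreal_ofReal.aemeasurable]
  refine lintegral_congr fun X => ?_
  exact lintegral_norm_sq_affine ((ridgeMatrix lam (Matrix.of X) * Matrix.of X - 1) *ᵥ β.ofLp)
    (σ • ridgeMatrix lam (Matrix.of X))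

theorem integral_frobenius_sq (hn : 0 < n) :
    Integrable (fun X : Fin n → Fin p → ℝ => ∑ i, ∑ j, X i j ^ 2)
        (Measure.pi fun _ : Fin n => Measure.pi fun _ : Fin p =>
          gaussianReal 0 ((n : ℝ≥0)⁻¹)) ∧
      ∫ X : Fin n → Fin p → ℝ, ∑ i, ∑ j, X i j ^ 2
        ∂(Measure.pi fun _ : Fin n => Measure.pi fun _ : Fin p =>
          gaussianReal 0 ((n : ℝ≥0)⁻¹)) = p := by
  set P := Measure.pi fun _ : Fin p => gaussianReal 0 ((n : ℝ≥0)⁻¹) with hP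
  have h1 : ∀ j : Fin p, Integrable (fun x : Fin p → ℝ => x j ^ 2) P := fun j =>
    integrable_comp_eval (μ := fun _ : Fin p => gaussianReal 0 ((n : ℝ≥0)⁻¹)) (i := j)
      (f := fun x : ℝ => x ^ 2) (integrable_pow_gaussianReal _ 2)
  have h1' : ∀ j : Fin p, ∫ x : Fin p → ℝ, x j ^ 2 ∂P = (n : ℝ)⁻¹ := fun j => by
    rw [hP, integral_comp_eval (μ := fun _ : Fin p => gaussianReal 0 ((n : ℝ≥0)⁻¹)) (i := j)
      (f := fun x : ℝ => x ^ 2) (by fun_prop), integral_sq_gaussianReal]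
    simp
  have h2 : ∀ i : Fin n, Integrable (fun X : Fin n → Fin p → ℝ => ∑ j, X i j ^ 2)
      (Measure.pi fun _ : Fin n => P) := fun i =>
    integrable_comp_eval (μ := fun _ : Fin n => P) (i := i)
      (f := fun x : Fin p → ℝ => ∑ j, x j ^ 2) (integrable_finsetSum _ fun j _ => h1 j)
  have h2' : ∀ i : Fin n, ∫ X : Fin n → Fin p → ℝ, ∑ j, X i j ^ 2
      ∂(Measure.pi fun _ : Fin n => P) = p * (n : ℝ)⁻¹ := fun i => by
    rw [integral_comp_eval (μ := fun _ : Fin n => P) (i := i)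
      (f := fun x : Fin p → ℝ => ∑ j, x j ^ 2) (Measurable.aestronglyMeasurable (by fun_prop)),
      integral_finsetSum _ fun j _ => h1 j]
    simp [h1']
  refine ⟨integrable_finsetSum _ fun i _ => h2 i, ?_⟩
  rw [integral_finsetSum _ fun i _ => h2 i]
  simp only [h2', Finset.sum_const, Finset.card_univ, Fintype.card_fin, nsmul_eq_mul]
  field_simp

/-- Lower bound for the Bayes risk of a linear estimator with matrix `M`. -/
theorem linear_bayes_risk_ge (M : Matrix (Fin p) (Fin n) ℝ) (X : Matrix (Fin n) (Fin p) ℝ)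
    {T s : ℝ} (hT : 0 ≤ T) (hs : 0 < s) :
    p * T - T ^ 2 / s * ∑ i, ∑ j, X i j ^ 2 ≤
      T * (∑ j, ∑ l, ((M * X - 1 : Matrix (Fin p) (Fin p) ℝ) l j) ^ 2) + s * ∑ l, ∑ i, M l i ^ 2 := by
  -- Only the diagonal entry survives, and its square `(M X)_jj²` is dropped as well.
  have h1 : ∀ j : Fin p, 1 - 2 * (M * X) j j ≤
      ∑ l, ((M * X - 1 : Matrix (Fin p) (Fin p) ℝ) l j) ^ 2 := by
    intro j
    refine le_trans ?_ (Finset.single_le_sum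
      (f := fun l => ((M * X - 1 : Matrix (Fin p) (Fin p) ℝ) l j) ^ 2)
      (fun l _ => sq_nonneg _) (Finset.mem_univ j))
    simp only [Matrix.sub_apply, Matrix.one_apply_eq]
    nlinarith [sq_nonneg ((M * X) j j)]
  have h2 : ∀ j : Fin p, T * (2 * (M * X) j j) ≤
      ∑ i, (T ^ 2 / s * X i j ^ 2 + s * M j i ^ 2) := by
    intro j
    rw [Matrix.mul_apply, Finset.mul_sum, Finset.mul_sum]
    refine Finset.sum_le_sum fun i _ => ?_
    -- Completing the square around `M = (T/s) Xᵀ`.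
    have h : T ^ 2 / s * X i j ^ 2 + s * M j i ^ 2 - T * (2 * (M j i * X i j)) =
      s * (T / s * X i j - M j i) ^ 2 := by field_simp; ring
    nlinarith [mul_nonneg hs.le (sq_nonneg (T / s * X i j - M j i))]
  have h3 := Finset.sum_le_sum fun j (_ : j ∈ Finset.univ) =>
    add_le_add (mul_le_mul_of_nonneg_left (h1 j) hT) (h2 j)
  simp only [Finset.sum_add_distrib, mul_sub, ← Finset.mul_sum, Finset.sum_sub_distrib,
    Finset.sum_const, Finset.card_univ, Fintype.card_fin, nsmul_eq_mul] at h3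
  rw [Finset.sum_comm (f := fun i j => X i j ^ 2)]
  linarith

/-- The prior puts the whole energy `k τ²` on one uniformly chosen coordinate. It has covariance
`(T/p) I`, which is all that a linear rule sees. The variance term does not depend on the spike, so
summing over `p` spikes gives the weight `s = p σ²`. -/
theorem supRisk_ridgeEstimator_ge {k : ℕ} (hn : 0 < n) (hp : 0 < p) (hk : 0 < k) {lam : ℝ}
    (hlam : 0 < lam) {σ : ℝ} (hσ : 0 < σ) (τ : ℝ) :
    ENNReal.ofReal (k * τ ^ 2 - (k * τ ^ 2) ^ 2 / (p * σ ^ 2)) ≤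
      supRisk (n := n) (p := p) k τ σ (ridgeEstimator lam) := by
  set T : ℝ := k * τ ^ 2 with hT
  have hT0 : 0 ≤ T := by positivity
  set β : Fin p → EuclideanSpace ℝ (Fin p) := fun j => EuclideanSpace.single j (√T) with hβ
  have hmem : ∀ j, β j ∈ paramSpace p k τ := by
    intro j
    constructor
    · refine le_trans ?_ hk
      refine (Set.ncard_le_ncard (t := {j}) ?_).trans (Set.ncard_singleton j).le
      intro l hl
      by_contra h
      exact hl (by simp [hβ, Set.mem_singleton_iff.not.1 h])
    · simp only [hβ, EuclideanSpace.single, PiLp.norm_single,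
        Real.norm_of_nonneg (Real.sqrt_nonneg T), Real.sq_sqrt hT0]
      exact le_of_eq hT
  set P := Measure.pi fun _ : Fin n => Measure.pi fun _ : Fin p =>
          gaussianReal 0 ((n : ℝ≥0)⁻¹) with hP
  have hm := measurable_ridgeMatrix (n := n) (p := p) lam
  have hs : 0 < p * σ ^ 2 := by positivity
  obtain ⟨hF, hF1⟩ := integral_frobenius_sq (p := p) hn
  have h1 : ENNReal.ofReal (p * T - T ^ 2 / (p * σ ^ 2) * p) ≤
      ∑ j, risk (n := n) σ (ridgeEstimator lam) (β j) := by
    have hint : Integrable (fun X : Fin n → Fin p → ℝ =>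
        p * T - T ^ 2 / (p * σ ^ 2) * ∑ i, ∑ j, X i j ^ 2) P :=
      (integrable_const _).sub (hF.const_mul _)
    have hval : ∫ X : Fin n → Fin p → ℝ, p * T - T ^ 2 / (p * σ ^ 2) * ∑ i, ∑ j, X i j ^ 2 ∂P =
        p * T - T ^ 2 / (p * σ ^ 2) * p := by
      rw [integral_sub (integrable_const _) (hF.const_mul _),
        integral_const_mul (T ^ 2 / (p * σ ^ 2)), hF1]
      simp
    simp only [risk_ridgeEstimator hlam]
    rw [← hval, ← lintegral_finsetSum]
    · refine (ofReal_integral_le_lintegral_ofReal hint).trans (lintegral_mono fun X => ?_)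
      rw [← ENNReal.ofReal_sum_of_nonneg fun j _ => by positivity]
      refine ENNReal.ofReal_le_ofReal ((linear_bayes_risk_ge
        (ridgeMatrix lam (Matrix.of X)) (Matrix.of X) hT0 hs).trans (le_of_eq ?_))
      have e : ∀ j l, (((ridgeMatrix lam (Matrix.of X) * Matrix.of X - 1) *ᵥ (β j).ofLp) l) ^ 2 =
          T * ((ridgeMatrix lam (Matrix.of X) * Matrix.of X - 1 :
             Matrix (Fin p) (Fin p) ℝ) l j) ^ 2 := by
        intro j l
        have : (β j).ofLp = Pi.single j (√T) := rfl
        rw [this, Matrix.mulVec_single]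
        simp only [Pi.smul_apply, Matrix.col_apply, MulOpposite.smul_eq_mul_unop,
          MulOpposite.unop_op, mul_pow, Real.sq_sqrt hT0]
        ring
      simp only [e, Matrix.smul_apply, smul_eq_mul, mul_pow,
        Finset.sum_add_distrib, ← Finset.mul_sum, Finset.sum_const,
        Finset.card_univ, Fintype.card_fin, nsmul_eq_mul]
      ring
    · intro j _
      refine (Finset.measurable_sum _ fun l _ => Measurable.add
        ((measurable_ridge_bias lam _ l).pow_const 2)
        (Finset.measurable_sum _ fun i _ => Measurable.pow_const ?_ 2)).ennreal_ofReal
      exact (hm l i).const_mul σ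
  have h2 : ∑ j, risk (n := n) σ (ridgeEstimator lam) (β j) ≤
      p * supRisk (n := n) (p := p) k τ σ (ridgeEstimator lam) := by
    refine (Finset.sum_le_card_nsmul Finset.univ _ _ fun j _ =>
      le_iSup₂ (f := fun b (_ : b ∈ paramSpace p k τ) => risk (n := n) σ (ridgeEstimator lam) b)
        (β j) (hmem j)).trans (le_of_eq ?_)
    simp [supRisk]
  have h3 : p * T - T ^ 2 / (p * σ ^ 2) * p = p * (T - T ^ 2 / (p * σ ^ 2)) := by ring
  have hp' : (p : ℝ≥0∞) ≠ 0 := by exact_mod_cast hp.ne'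
  rw [h3, ENNReal.ofReal_mul (by positivity), ENNReal.ofReal_natCast] at h1
  exact (ENNReal.mul_le_mul_iff_right hp' (ENNReal.natCast_ne_top p)).1 (h1.trans h2)

/-! ### Upper bound for ridge as the penalty grows -/

theorem ridgeMatrix_normal_eq {lam : ℝ} (hlam : 0 < lam) (X : Matrix (Fin n) (Fin p) ℝ) :
    (Xᵀ * X + lam • (1 : Matrix (Fin p) (Fin p) ℝ)) * ridgeMatrix lam X = Xᵀ := by
  have hpos : (Xᵀ * X + lam • (1 : Matrix (Fin p) (Fin p) ℝ)).PosDef := by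
    have h1 : (Xᵀ * X).PosSemidef := by
      simpa using Matrix.posSemidef_conjTranspose_mul_self X
    exact Matrix.PosDef.posSemidef_add h1 (Matrix.PosDef.one.smul hlam)
  rw [ridgeMatrix, Matrix.mul_nonsing_inv_cancel_left _ _
    ((Matrix.isUnit_iff_isUnit_det _).1 hpos.isUnit)]

theorem dotProduct_regularizedGram_mulVec (lam : ℝ) (X : Matrix (Fin n) (Fin p) ℝ)
    (h : Fin p → ℝ) :
    h ⬝ᵥ ((Xᵀ * X + lam • (1 : Matrix (Fin p) (Fin p) ℝ)) *ᵥ h) =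
      (X *ᵥ h) ⬝ᵥ (X *ᵥ h) + lam * (h ⬝ᵥ h) := by
  rw [Matrix.add_mulVec, dotProduct_add, Matrix.smul_mulVec, Matrix.one_mulVec, dotProduct_smul,
    ← Matrix.mulVec_mulVec, Matrix.mulVec_transpose, dotProduct_comm h, ← Matrix.dotProduct_mulVec,
    smul_eq_mul]

/-- Pairing the normal equations with the column `h` gives `‖X h‖² + lam ‖h‖² = (X h) i`, and `x -
x² ≤ 1/4`. -/
theorem sum_ridgeMatrix_col_sq_le {lam : ℝ} (hlam : 0 < lam) (X : Matrix (Fin n) (Fin p) ℝ)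
    (i : Fin n) : ∑ l, ridgeMatrix lam X l i ^ 2 ≤ 1 / (4 * lam) := by
  set h : Fin p → ℝ := ridgeMatrix lam X *ᵥ Pi.single i 1 with hh
  have hl : ∀ l, h l = ridgeMatrix lam X l i := fun l => by simp [hh]
  have h1 := dotProduct_regularizedGram_mulVec lam X h
  have h2 : (Xᵀ * X + lam • (1 : Matrix (Fin p) (Fin p) ℝ)) *ᵥ h = Xᵀ *ᵥ Pi.single i 1 := by
    rw [hh, Matrix.mulVec_mulVec, ridgeMatrix_normal_eq hlam]
  rw [h2, Matrix.mulVec_transpose, dotProduct_comm, ← Matrix.dotProduct_mulVec,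
    single_one_dotProduct] at h1
  have h3 : (X *ᵥ h) i ^ 2 ≤ (X *ᵥ h) ⬝ᵥ (X *ᵥ h) := by
    rw [pow_two]
    exact Finset.single_le_sum (f := fun i => (X *ᵥ h) i * (X *ᵥ h) i)
      (fun _ _ => mul_self_nonneg _) (Finset.mem_univ i)
  have h4 : h ⬝ᵥ h = ∑ l, ridgeMatrix lam X l i ^ 2 :=
    Finset.sum_congr rfl fun l _ => by rw [hl, pow_two]
  rw [← h4, le_div_iff₀ (by positivity)]
  nlinarith [sq_nonneg ((X *ᵥ h) i - 1 / 2)]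

/-- The bias `w` solves `(Xᵀ X + lam) w = -lam b`. Pairing with `w` gives `‖w‖² ≤ -⟨w, b⟩ ≤ (‖w‖² +
‖b‖²)/2`. -/
theorem sum_ridge_bias_sq_le {lam : ℝ} (hlam : 0 < lam) (X : Matrix (Fin n) (Fin p) ℝ)
    (b : Fin p → ℝ) : ∑ l, (((ridgeMatrix lam X * X - 1) *ᵥ b) l) ^ 2 ≤ ∑ l, b l ^ 2 := by
  set w := (ridgeMatrix lam X * X - 1) *ᵥ b with hw
  have h1 := dotProduct_regularizedGram_mulVec lam X w
  have h2 : (Xᵀ * X + lam • (1 : Matrix (Fin p) (Fin p) ℝ)) *ᵥ w = -(lam • b) := by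
    rw [hw, Matrix.mulVec_mulVec, Matrix.mul_sub, ← Matrix.mul_assoc,
      ridgeMatrix_normal_eq hlam, Matrix.mul_one,
      sub_add_cancel_left, Matrix.neg_mulVec, Matrix.smul_mulVec, Matrix.one_mulVec]
  rw [h2, dotProduct_neg, dotProduct_smul, smul_eq_mul] at h1
  have h3 : 0 ≤ (X *ᵥ w) ⬝ᵥ (X *ᵥ w) := Finset.sum_nonneg fun i _ => mul_self_nonneg _
  have h4 : w ⬝ᵥ w = ∑ l, w l ^ 2 := Finset.sum_congr rfl fun l _ => by rw [pow_two]
  have h5 : -2 * (w ⬝ᵥ b) ≤ ∑ l, w l ^ 2 + ∑ l, b l ^ 2 := by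
    rw [dotProduct, Finset.mul_sum, ← Finset.sum_add_distrib]
    exact Finset.sum_le_sum fun l _ => by nlinarith [sq_nonneg (w l + b l)]
  rw [h4] at h1
  have h6 : ∑ l, w l ^ 2 ≤ -(w ⬝ᵥ b) := by
    by_contra hc
    push Not at hc
    nlinarith [mul_lt_mul_of_pos_left hc hlam]
  linarith

theorem risk_ridgeEstimator_le {lam : ℝ} (hlam : 0 < lam) (σ : ℝ) (β : EuclideanSpace ℝ (Fin p)) :
    risk (n := n) σ (ridgeEstimator lam) β ≤
      ENNReal.ofReal (‖β‖ ^ 2 + σ ^ 2 * n / (4 * lam)) := by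
  rw [risk_ridgeEstimator hlam]
  refine (lintegral_mono (g := fun _ => ENNReal.ofReal (‖β‖ ^ 2 + σ ^ 2 * n / (4 * lam)))
    fun X => ENNReal.ofReal_le_ofReal ?_).trans (by simp)
  rw [Finset.sum_add_distrib, EuclideanSpace.real_norm_sq_eq]
  refine add_le_add (sum_ridge_bias_sq_le hlam (Matrix.of X) β.ofLp) ?_
  rw [Finset.sum_comm]
  have h := Finset.sum_le_sum fun i (_ : i ∈ Finset.univ) =>
    sum_ridgeMatrix_col_sq_le hlam (Matrix.of X) i
  simp only [Matrix.smul_apply, smul_eq_mul, mul_pow, ← Finset.mul_sum]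
  refine (mul_le_mul_of_nonneg_left h (sq_nonneg σ)).trans (le_of_eq ?_)
  simp only [Finset.sum_const, Finset.card_univ, Fintype.card_fin, nsmul_eq_mul]
  ring

theorem ridgeOptimalRisk_le (n p k : ℕ) (τ σ : ℝ) :
    ridgeOptimalRisk n p k τ σ ≤ ENNReal.ofReal (k * τ ^ 2) := by
  have h : ∀ lam : ℝ, 0 < lam →
      ridgeOptimalRisk n p k τ σ ≤ ENNReal.ofReal (k * τ ^ 2 + σ ^ 2 * n / (4 * lam)) :=
    fun lam hlam => (iInf₂_le lam hlam).trans (iSup₂_le fun β hβ =>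
      (risk_ridgeEstimator_le hlam σ β).trans (ENNReal.ofReal_le_ofReal (by linarith [hβ.2])))
  have hlim : Tendsto (fun lam : ℝ => ENNReal.ofReal (k * τ ^ 2 + σ ^ 2 * n / (4 * lam))) atTop
      (𝓝 (ENNReal.ofReal (k * τ ^ 2 + 0))) :=
    ENNReal.tendsto_ofReal (tendsto_const_nhds.add
      (tendsto_const_nhds.div_atTop (tendsto_id.const_mul_atTop (by norm_num))))
  rw [add_zero] at hlim
  exact ge_of_tendsto hlim ((eventually_gt_atTop 0).mono h)

theorem ridgeOptimalRisk_ge {k : ℕ} (hn : 0 < n) (hp : 0 < p) (hk : 0 < k) {σ : ℝ} (hσ : 0 < σ)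
    (τ : ℝ) : ENNReal.ofReal (k * τ ^ 2 - (k * τ ^ 2) ^ 2 / (p * σ ^ 2)) ≤
      ridgeOptimalRisk n p k τ σ :=
  le_iInf₂ fun _ hlam => supRisk_ridgeEstimator_ge hn hp hk hlam hσ τ

end Ridge

/-! ### Comparison of the two gains -/

theorem ridgeOptimalRisk_toReal_mem {n p k : ℕ} (hn : 0 < n) (hp : 0 < p) (hk : 0 < k) {σ : ℝ}
    (hσ : 0 < σ) (τ : ℝ) :
    k * τ ^ 2 - (k * τ ^ 2) ^ 2 / (p * σ ^ 2) ≤ (ridgeOptimalRisk n p k τ σ).toReal ∧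
      (ridgeOptimalRisk n p k τ σ).toReal ≤ k * τ ^ 2 := by
  have h := ridgeOptimalRisk_le n p k τ σ
  exact ⟨(ENNReal.ofReal_le_iff_le_toReal (h.trans_lt ENNReal.ofReal_lt_top).ne).1
    (ridgeOptimalRisk_ge hn hp hk hσ τ), ENNReal.toReal_le_of_le_ofReal (by positivity) h⟩

/-- With `μ = τ/σ`, a factor `c` of order strictly between `(k/p) μ²` and `(k/p) μ⁴` beats the ridge
gain while keeping the null cost small; the cube lies between them. The numerical hypotheses make
each of the three error terms at most `c k τ²/4`, so `7c/4` drops to `c`. -/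
theorem sparseMinimaxRisk_toReal_le {n p k : ℕ} (hn : 0 < n) (hp : 0 < p) {σ τ c : ℝ}
    (hσ : 0 < σ) (hτ : σ ≤ τ) (hkn : k * τ ^ 2 / n ≤ σ ^ 2) (hc : c = k / p * (τ / σ) ^ 3)
    (hc1 : c ≤ 1 / 8) (hc2 : c * gaussianFourthMoment ≤ 1 / 4)
    (hμ : 1024 * gaussianFourthMoment ^ 2 ≤ τ / σ) :
    (sparseMinimaxRisk n p k τ σ).toReal ≤ k * τ ^ 2 * (1 - c) := by
  have hτ0 : 0 < τ := hσ.trans_le hτ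
  have hp' : (0 : ℝ) < p := by exact_mod_cast hp
  have hc0 : 0 ≤ c := by rw [hc]; positivity
  refine ENNReal.toReal_le_of_le_ofReal (mul_nonneg (by positivity) (by linarith))
    ((sparseMinimaxRisk_le hn hc0 (by linarith) hτ0 hkn).trans (ENNReal.ofReal_le_ofReal ?_))
  have hT : (0 : ℝ) ≤ c * (k * τ ^ 2) := by positivity
  have h1 : c ^ 2 * gaussianFourthMoment * (k * τ ^ 2) ≤ c * (k * τ ^ 2) / 4 := by
    nlinarith [mul_le_mul_of_nonneg_left hc2 hT]
  have h2 : 2 * k * c ^ 2 * σ ^ 2 ≤ c * (k * τ ^ 2) / 4 := by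
    have h : σ ^ 2 ≤ τ ^ 2 := pow_le_pow_left₀ hσ.le hτ 2
    have h' : 2 * c * σ ^ 2 ≤ τ ^ 2 / 4 := by nlinarith [sq_nonneg σ]
    have hkc : 0 ≤ k * c := by positivity
    nlinarith [mul_le_mul_of_nonneg_left h' hkc]
  have h3 : 256 * gaussianFourthMoment ^ 2 * p * c ^ 2 * σ ^ 4 / τ ^ 2 ≤
      c * (k * τ ^ 2) / 4 := by
    have e1 : 256 * gaussianFourthMoment ^ 2 * p * c ^ 2 * σ ^ 4 / τ ^ 2 =
        c * k * τ * σ / 4 * (1024 * gaussianFourthMoment ^ 2) := by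
      have : p * c = k * (τ / σ) ^ 3 := by rw [hc]; field_simp
      calc _ = 256 * gaussianFourthMoment ^ 2 * (p * c) * c * σ ^ 4 / τ ^ 2 := by ring
        _ = _ := by rw [this]; field_simp; ring
    have e2 : c * (k * τ ^ 2) / 4 = c * k * τ * σ / 4 * (τ / σ) := by field_simp
    rw [e1, e2]
    exact mul_le_mul_of_nonneg_left hμ (by positivity)
  nlinarith

/-- With `L = log (1/ε)`, `μ³ ≤ μ⁴ ≤ L²`, and `L² e^{-L} → 0`. -/
theorem tendsto_mul_cube_of_sq_le_log_inv {ε μ : ℕ → ℝ} (hε : ∀ m, 0 < ε m)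
    (h0 : Tendsto ε atTop (𝓝 0)) (hμ : ∀ᶠ m in atTop, 1 ≤ μ m)
    (hle : ∀ᶠ m in atTop, μ m ^ 2 ≤ Real.log (ε m)⁻¹) :
    Tendsto (fun m => ε m * μ m ^ 3) atTop (𝓝 0) := by
  have hL : Tendsto (fun m => Real.log (ε m)⁻¹) atTop atTop :=
    Real.tendsto_log_atTop.comp ((tendsto_nhdsWithin_iff.2
      ⟨h0, Eventually.of_forall hε⟩).inv_tendsto_nhdsGT_zero)
  have hlim := (Real.tendsto_pow_mul_exp_neg_atTop_nhds_zero 2).comp hL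
  refine squeeze_zero' (hμ.mono fun m hm => ?_) ?_ hlim
  · have := (hε m).le
    positivity
  · filter_upwards [hμ, hle] with m hm hm'
    have h1 : Real.exp (-Real.log (ε m)⁻¹) = ε m := by
      rw [Real.log_inv, neg_neg, Real.exp_log (hε m)]
    simp only [Function.comp_apply, h1]
    rw [mul_comm]
    refine mul_le_mul_of_nonneg_right ?_ (hε m).le
    calc μ m ^ 3 ≤ μ m ^ 4 := pow_le_pow_right₀ hm (by norm_num)
      _ = (μ m ^ 2) ^ 2 := by ring
      _ ≤ _ := pow_le_pow_left₀ (sq_nonneg _) hm' 2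

theorem mainTheorem5 (n p k : ℕ → ℕ) (τ σ : ℕ → ℝ)
    (hn : ∀ m, 0 < n m) (hp : ∀ m, 0 < p m) (hk : ∀ m, 0 < k m) (hσ : ∀ m, 0 < σ m)
    (hkp : Tendsto (fun m => (k m : ℝ) / p m) atTop (𝓝 0))
    (hsnr : Tendsto (fun m => τ m / σ m) atTop atTop)
    (hsnr' : (fun m => τ m / σ m) =o[atTop] fun m => Real.sqrt (Real.log ((p m : ℝ) / k m)))
    (hkn : Tendsto (fun m => (k m : ℝ) * Real.log ((p m : ℝ) / k m) / n m) atTop (𝓝 0)) :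
    (∃ δ : ℕ → ℝ, Tendsto δ atTop (𝓝 0) ∧
      ∀ᶠ m in atTop,
        k m * τ m ^ 2 * (1 - k m * τ m ^ 2 / (p m * σ m ^ 2) * (1 + δ m)) ≤
          (ridgeOptimalRisk (n m) (p m) (k m) (τ m) (σ m)).toReal) ∧
    (fun m => k m * τ m ^ 2 - (ridgeOptimalRisk (n m) (p m) (k m) (τ m) (σ m)).toReal) =o[atTop]
      (fun m => k m * τ m ^ 2 - (sparseMinimaxRisk (n m) (p m) (k m) (τ m) (σ m)).toReal) := by
  have hridge := fun m => ridgeOptimalRisk_toReal_mem (hn m) (hp m) (hk m) (hσ m) (τ m)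
  -- The ridge bound is non-asymptotic, so the error term can be taken to be zero.
  refine ⟨⟨fun _ => 0, tendsto_const_nhds, Eventually.of_forall fun m => ?_⟩, ?_⟩
  · refine le_trans (le_of_eq ?_) (hridge m).1
    ring
  have hp' : ∀ m, (0 : ℝ) < p m := fun m => by exact_mod_cast hp m
  have hk' : ∀ m, (0 : ℝ) < k m := fun m => by exact_mod_cast hk m
  have hn' : ∀ m, (0 : ℝ) < n m := fun m => by exact_mod_cast hn m
  have hlog : ∀ᶠ m in atTop, (τ m / σ m) ^ 2 ≤ Real.log ((p m : ℝ) / k m) := by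
    filter_upwards [hsnr'.bound one_pos, hsnr.eventually_ge_atTop 1] with m h1 h2
    rw [one_mul, Real.norm_of_nonneg (by linarith), Real.norm_of_nonneg (Real.sqrt_nonneg _)] at h1
    exact (Real.le_sqrt' (by linarith)).1 h1
  have hc : Tendsto (fun m => (k m : ℝ) / p m * (τ m / σ m) ^ 3) atTop (𝓝 0) := by
    refine tendsto_mul_cube_of_sq_le_log_inv (fun m => div_pos (hk' m) (hp' m)) hkp
      (hsnr.eventually_ge_atTop 1) ?_
    simpa only [inv_div] using hlog
  have hcκ : Tendsto (fun m => (k m : ℝ) / p m * (τ m / σ m) ^ 3 * gaussianFourthMoment) atTop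
      (𝓝 0) := by simpa using hc.mul_const gaussianFourthMoment
  refine isLittleO_iff.2 fun C hC => ?_
  filter_upwards [hlog, hc.eventually_le_const (show (0 : ℝ) < 1 / 8 by norm_num),
    hcκ.eventually_le_const (show (0 : ℝ) < 1 / 4 by norm_num),
    hsnr.eventually_ge_atTop (1024 * gaussianFourthMoment ^ 2), hsnr.eventually_ge_atTop 1,
    hsnr.eventually_ge_atTop (1 / C), hkn.eventually_le_const one_pos] with m h1 h2 h3 h4 h5 h6 h7
  have hσm := hσ m
  have hτσ : σ m ≤ τ m := (one_le_div hσm).1 h5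
  have hτm : 0 < τ m := hσm.trans_le hτσ
  have hkτ : k m * τ m ^ 2 / n m ≤ σ m ^ 2 := by
    rw [div_le_one (hn' m)] at h7
    rw [div_le_iff₀ (hn' m)]
    have h8 : (k m : ℝ) * (τ m / σ m) ^ 2 ≤ n m :=
      (mul_le_mul_of_nonneg_left h1 (hk' m).le).trans h7
    rw [div_pow, mul_div_assoc', div_le_iff₀ (by positivity)] at h8
    linarith
  have hR := sparseMinimaxRisk_toReal_le (hn m) (hp m) hσm hτσ hkτ rfl h2 h3 h4
  have hgain : k m * τ m ^ 2 * (k m / p m * (τ m / σ m) ^ 3) ≤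
      k m * τ m ^ 2 - (sparseMinimaxRisk (n m) (p m) (k m) (τ m) (σ m)).toReal := by linarith
  have hpm := hp' m
  have hgain0 : 0 ≤ k m * τ m ^ 2 * (k m / p m * (τ m / σ m) ^ 3) := by positivity
  rw [Real.norm_of_nonneg (sub_nonneg.2 (hridge m).2), Real.norm_of_nonneg (hgain0.trans hgain)]
  -- The ridge gain has `(τ/σ)²` where the minimax gain has `(τ/σ)³`; the spare factor absorbs `C`.
  have hC1 : 1 ≤ C * (τ m / σ m) := by
    rw [div_le_iff₀ hC] at h6
    linarith
  calc k m * τ m ^ 2 - (ridgeOptimalRisk (n m) (p m) (k m) (τ m) (σ m)).toReal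
      ≤ (k m * τ m ^ 2) ^ 2 / (p m * σ m ^ 2) := by linarith [(hridge m).1]
    _ = 1 * (k m * τ m ^ 2 * (k m / p m * (τ m / σ m) ^ 2)) := by field_simp
    _ ≤ C * (τ m / σ m) * (k m * τ m ^ 2 * (k m / p m * (τ m / σ m) ^ 2)) :=
        mul_le_mul_of_nonneg_right hC1 (by positivity)
    _ = C * (k m * τ m ^ 2 * (k m / p m * (τ m / σ m) ^ 3)) := by ring
    _ ≤ _ := mul_le_mul_of_nonneg_left hgain hC.le
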